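/- For $n=1,2,\dots$ let $y_n(z)=\sum_{k=0}^{n}\frac{(n+k)!}{(n-k)!\,k!}\left(\frac z2\right)^k$ be the $n$th Bessel polynomial, let $\alpha_{n1},\dots,\alpha_{nn}$ be its complex zeros (counted with multiplicity), and put $$A_m^n=\sum_{k=1}^n\left(a_{nk}^m-b_{nk}^m\right),\qquad a_{nk}=1-\frac{\alpha_{nk}}2,\quad b_{nk}=1+\frac{\alpha_{nk}}2 .$$ For $x\in(0,1)$ put $n_0(x)=\max\{14,\ x^2(1-x)^{-2}\}-1$. If $x\in(0,1)$ and $n$ is a positive integer with $n\ge n_0(x)$, then $$|m-A_m^n|<\frac{2x^{2n+1-m}}{(1-x)^{2n+2}}\,\frac{n!^2}{(2n)!^2}\qquad\text{for all integers } m\ge 2n+1 .$$ -/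

import Mathlib

open Polynomial

noncomputable section

/-- The `n`th Bessel polynomial
`y_n(z) = ∑_{k=0}^n (n+k)! / ((n-k)! k!) * (z/2)^k`, over the complex numbers. -/
def besselPoly (n : ℕ) : ℂ[X] :=
  ∑ k ∈ Finset.range (n + 1),
    C (((n + k).factorial : ℂ) / (((n - k).factorial : ℂ) * (k.factorial : ℂ))) *
      (C (1 / 2) * X) ^ k

/-- `a = 1 - α / 2`, for a zero `α` of a Bessel polynomial. -/
def nodeA (α : ℂ) : ℂ := 1 - α / 2

/-- `b = 1 + α / 2`, for a zero `α` of a Bessel polynomial. -/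
def nodeB (α : ℂ) : ℂ := 1 + α / 2

/-- `A_m^n = ∑_{k=1}^n (a_{nk}^m - b_{nk}^m)`, the sum being over all complex zeros of the `n`th
Bessel polynomial (counted with multiplicity). -/
def besselA (n m : ℕ) : ℂ :=
  ((besselPoly n).roots.map fun α => nodeA α ^ m - nodeB α ^ m).sum

/-- The threshold `n_0(x) = max {14, x^2 (1-x)^(-2)} - 1`. -/
def nZero (x : ℝ) : ℝ := max 14 (x ^ 2 / (1 - x) ^ 2) - 1

end

/-! Let θ be the reverse of the Bessel polynomial, a constant times ∏(1 - αs). With s = z/(2(1-z))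
one has 1 - az = (1-z)(1+αs) and 1 - bz = (1-z)(1-αs), so the generating function of A_m is
expressed through the logarithmic derivatives of θ at s and -s. A Wronskian identity
(`besselTheta_wronskian`) evaluates these, and ∑(m - A_m)z^m becomes an explicit multiple of
s^(2n)/(θ(s)θ(-s)) (`generating_sum_eq`).

The claim is then Cauchy's estimate on |z| = x, where |s| ≤ x/(2(1-x)). It needs a lower bound for
θ(s)θ(-s) (`le_norm_eval_besselThetaProd`): this even polynomial has a two-term coefficient
recurrence, whose rapid decay makes the constant term dominate for |s|² ≤ (n+1)/4, which is what n ≥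
n₀(x) guarantees. -/

theorem coeff_comp_neg_X {R : Type*} [CommRing R] (p : R[X]) (j : ℕ) :
    (p.comp (-X)).coeff j = (-1) ^ j * p.coeff j := by
  rw [show (-X : R[X]) = C (-1) * X by simp, comp_C_mul_X_coeff, mul_comm]

theorem besselPoly_coeff (n k : ℕ) : (besselPoly n).coeff k =
    if k ≤ n then ((n + k).factorial : ℂ) / ((n - k).factorial * k.factorial) * (1 / 2) ^ k
    else 0 := by
  simp only [besselPoly, mul_pow, ← C_pow, ← mul_assoc, ← C_mul, finsetSum_coeff, coeff_C_mul_X_pow]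
  rw [Finset.sum_ite_eq]
  simp

theorem besselPoly_natDegree (n : ℕ) : (besselPoly n).natDegree = n := by
  refine natDegree_eq_of_le_of_coeff_ne_zero ?_ ?_
  · rw [natDegree_le_iff_coeff_eq_zero]
    intro k hk
    rw [besselPoly_coeff, if_neg (by omega)]
  · rw [besselPoly_coeff, if_pos le_rfl]
    have h1 : ((n + n).factorial : ℂ) ≠ 0 := by exact_mod_cast Nat.factorial_ne_zero _
    have h2 : (n.factorial : ℂ) ≠ 0 := by exact_mod_cast Nat.factorial_ne_zero _
    simp [h1, h2]

/-! ### The reverse Bessel polynomial, its differential equation and Wronskian -/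

/-- The reverse Bessel polynomial. -/
noncomputable def besselTheta (n : ℕ) : ℂ[X] := (besselPoly n).reverse

theorem besselTheta_coeff (n j : ℕ) : (besselTheta n).coeff j =
    if j ≤ n then ((2 * n - j).factorial : ℂ) / (j.factorial * (n - j).factorial) *
      (1 / 2) ^ (n - j) else 0 := by
  rw [besselTheta, coeff_reverse, besselPoly_natDegree, besselPoly_coeff]
  split_ifs with h1 h2 h2
  · rw [revAt_le h2, show n + (n - j) = 2 * n - j by omega, show n - (n - j) = j by omega]
  · rw [revAt_eq_self_of_lt (by omega)] at h1; omega
  · rw [revAt_le h2] at h1; omega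
  · rfl

theorem besselTheta_coeff_self (n : ℕ) : (besselTheta n).coeff n = 1 := by
  rw [besselTheta_coeff, if_pos le_rfl, show 2 * n - n = n by omega]
  have : (n.factorial : ℂ) ≠ 0 := by exact_mod_cast n.factorial_ne_zero
  simp [this]

theorem besselTheta_natDegree (n : ℕ) : (besselTheta n).natDegree = n := by
  refine natDegree_eq_of_le_of_coeff_ne_zero ?_ (by simp [besselTheta_coeff_self])
  rw [natDegree_le_iff_coeff_eq_zero]
  intro k hk
  rw [besselTheta_coeff, if_neg (by omega)]

theorem besselTheta_coeff_zero (n : ℕ) : (besselTheta n).coeff 0 =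
    ((2 * n).factorial : ℂ) / n.factorial * (1 / 2) ^ n := by
  simp [besselTheta_coeff]

/-- Coefficient form of the differential equation below; cleared of denominators, it also holds for
j ≥ n, where both sides vanish. -/
theorem besselTheta_coeff_succ (n j : ℕ) :
    ((j : ℂ) + 1) * (2 * n - j) * (besselTheta n).coeff (j + 1) =
      2 * (n - j) * (besselTheta n).coeff j := by
  rcases lt_trichotomy j n with h | rfl | h
  · obtain ⟨d, rfl⟩ := Nat.exists_eq_add_of_lt h
    rw [besselTheta_coeff, besselTheta_coeff, if_pos (by omega), if_pos (by omega),
      show 2 * (j + d + 1) - j = (j + 2 * d + 1) + 1 by omega,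
      show 2 * (j + d + 1) - (j + 1) = j + 2 * d + 1 by omega,
      show j + d + 1 - (j + 1) = d by omega, show j + d + 1 - j = d + 1 by omega,
      Nat.factorial_succ j, Nat.factorial_succ d, Nat.factorial_succ (j + 2 * d + 1)]
    have h1 : (d.factorial : ℂ) ≠ 0 := by exact_mod_cast d.factorial_ne_zero
    have h2 : (j.factorial : ℂ) ≠ 0 := by exact_mod_cast j.factorial_ne_zero
    have h3 : (d : ℂ) + 1 ≠ 0 := by exact_mod_cast d.succ_ne_zero
    have h4 : (j : ℂ) + 1 ≠ 0 := by exact_mod_cast j.succ_ne_zero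
    push_cast
    field_simp
    ring
  · rw [besselTheta_coeff, if_neg (by omega)]; simp
  · rw [besselTheta_coeff, besselTheta_coeff, if_neg (by omega), if_neg (by omega)]; simp

theorem besselTheta_ode (n : ℕ) :
    X * derivative (derivative (besselTheta n)) =
      2 * (X + (n : ℂ[X])) * derivative (besselTheta n) - 2 * (n : ℂ[X]) * besselTheta n := by
  have e : 2 * (X + (n : ℂ[X])) * derivative (besselTheta n) - 2 * (n : ℂ[X]) * besselTheta n =
      C 2 * (X * derivative (besselTheta n)) + C (2 * n : ℂ) * derivative (besselTheta n)
        - C (2 * n : ℂ) * besselTheta n := by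
    simp only [C_mul, C_eq_natCast, map_ofNat]; ring
  rw [e]
  ext j
  have h := besselTheta_coeff_succ n j
  simp only [coeff_sub, coeff_add, coeff_C_mul]
  cases j with
  | zero =>
    simp only [coeff_X_mul_zero, coeff_derivative]
    push_cast at h ⊢
    linear_combination -h
  | succ j =>
    simp only [coeff_X_mul, coeff_derivative]
    push_cast at h ⊢
    linear_combination -h

/-- The reverse Bessel polynomial with the argument negated. -/
noncomputable def besselThetaNeg (n : ℕ) : ℂ[X] := (besselTheta n).comp (-X)

theorem besselThetaNeg_coeff (n j : ℕ) :
    (besselThetaNeg n).coeff j = (-1) ^ j * (besselTheta n).coeff j := by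
  rw [besselThetaNeg, coeff_comp_neg_X]

theorem derivative_besselThetaNeg (n : ℕ) :
    derivative (besselThetaNeg n) = -(derivative (besselTheta n)).comp (-X) := by
  simp [besselThetaNeg, derivative_comp]

theorem besselThetaNeg_ode (n : ℕ) :
    X * derivative (derivative (besselThetaNeg n)) =
      2 * ((n : ℂ[X]) - X) * derivative (besselThetaNeg n)
        + 2 * (n : ℂ[X]) * besselThetaNeg n := by
  have h := congrArg (fun f : ℂ[X] => f.comp (-X)) (besselTheta_ode n)
  simp only [mul_comp, sub_comp, add_comp, X_comp, natCast_comp, ofNat_comp] at h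
  rw [derivative_besselThetaNeg]
  simp only [derivative_neg, derivative_comp, derivative_X, besselThetaNeg]
  linear_combination -h

theorem besselThetaNeg_natDegree (n : ℕ) : (besselThetaNeg n).natDegree = n := by
  rw [besselThetaNeg, natDegree_comp, natDegree_neg, natDegree_X, besselTheta_natDegree, mul_one]

/-- By the two differential equations the left side W satisfies sW' = 2nW, so it is a multiple of
s^(2n). Only the undifferentiated product has degree 2n, and it fixes the constant. -/
theorem besselTheta_wronskian {n : ℕ} (hn : 0 < n) :
    derivative (besselTheta n) * besselThetaNeg n - besselTheta n * derivative (besselThetaNeg n)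
      - 2 * (besselTheta n * besselThetaNeg n) = C (-2 * (-1) ^ n) * X ^ (2 * n) := by
  set W := derivative (besselTheta n) * besselThetaNeg n
    - besselTheta n * derivative (besselThetaNeg n)
    - 2 * (besselTheta n * besselThetaNeg n) with hW
  have ode : X * derivative W = C (2 * n : ℂ) * W := by
    simp only [C_mul, C_eq_natCast, map_ofNat]
    simp only [hW, derivative_sub, derivative_mul, derivative_ofNat]
    linear_combination besselThetaNeg n * besselTheta_ode n
      - besselTheta n * besselThetaNeg_ode n
  ext j
  rw [coeff_C_mul_X_pow]
  split_ifs with hj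
  · subst hj
    have d1 := natDegree_derivative_lt (p := besselTheta n) (by rw [besselTheta_natDegree]; omega)
    have d2 := natDegree_derivative_lt (p := besselThetaNeg n)
      (by rw [besselThetaNeg_natDegree]; omega)
    rw [besselTheta_natDegree] at d1
    rw [besselThetaNeg_natDegree] at d2
    have c1 : (derivative (besselTheta n) * besselThetaNeg n).coeff (2 * n) = 0 :=
      coeff_eq_zero_of_natDegree_lt (natDegree_mul_le.trans_lt
        (by rw [besselThetaNeg_natDegree]; omega))
    have c2 : (besselTheta n * derivative (besselThetaNeg n)).coeff (2 * n) = 0 :=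
      coeff_eq_zero_of_natDegree_lt (natDegree_mul_le.trans_lt
        (by rw [besselTheta_natDegree]; omega))
    have c3 : (besselTheta n * besselThetaNeg n).coeff (2 * n) = (-1) ^ n := by
      rw [two_mul, coeff_mul_add_eq_of_natDegree_le (besselTheta_natDegree n).le
        (besselThetaNeg_natDegree n).le, besselThetaNeg_coeff, besselTheta_coeff_self]
      ring
    rw [hW, coeff_sub, coeff_sub, c1, c2, ← C_ofNat, coeff_C_mul, c3]
    ring
  · have h := congrArg (fun f : ℂ[X] => f.coeff j) ode
    have h2 : (j : ℂ) * W.coeff j = 2 * n * W.coeff j := by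
      cases j with
      | zero => simpa using h
      | succ j =>
        simp only [coeff_X_mul, coeff_derivative, coeff_C_mul] at h
        push_cast at h ⊢
        linear_combination h
    have h3 : ((j : ℂ) - 2 * n) * W.coeff j = 0 := by linear_combination h2
    rcases mul_eq_zero.1 h3 with h4 | h4
    · exfalso; apply hj
      have : (j : ℂ) = ((2 * n : ℕ) : ℂ) := by push_cast; linear_combination h4
      exact_mod_cast this
    · exact h4

/-! ### Coefficients and lower bound of the product -/

/-- The product `θ_n(s) θ_n(-s)`. -/
noncomputable def besselThetaProd (n : ℕ) : ℂ[X] := besselTheta n * besselThetaNeg n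

/-- A product of solutions of two second-order linear equations satisfies a linear equation of
higher order; here order three suffices. -/
theorem besselThetaProd_ode (n : ℕ) :
    X ^ 2 * derivative (derivative (derivative (besselThetaProd n)))
      - 6 * (n : ℂ[X]) * X * derivative (derivative (besselThetaProd n))
      + (2 * (n : ℂ[X]) + 8 * (n : ℂ[X]) ^ 2) * derivative (besselThetaProd n)
      - 4 * X ^ 2 * derivative (besselThetaProd n) + 8 * (n : ℂ[X]) * X * besselThetaProd n
      = 0 := by
  have e1 := besselTheta_ode n
  have e2 := besselThetaNeg_ode n
  have d1 := congrArg derivative e1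
  have d2 := congrArg derivative e2
  simp only [derivative_sub, derivative_add, derivative_mul, derivative_ofNat, derivative_X,
    derivative_natCast] at d1 d2
  simp only [besselThetaProd, derivative_mul, derivative_add]
  linear_combination X * besselThetaNeg n * d1 + X * besselTheta n * d2
    + ((2 * X - 4 * n - 1) * besselThetaNeg n + 3 * X * derivative (besselThetaNeg n)) * e1
    + ((-2 * X - 4 * n - 1) * besselTheta n + 3 * X * derivative (besselTheta n)) * e2

theorem besselThetaProd_coeff_add_two (n j : ℕ) :
    ((j : ℂ) + 2) * (2 * n - 1 - j) * (4 * n - j) * (besselThetaProd n).coeff (j + 2) =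
      -4 * (2 * n - j) * (besselThetaProd n).coeff j := by
  have e : X * (X * derivative (derivative (derivative (besselThetaProd n))))
      - C (6 * n : ℂ) * (X * derivative (derivative (besselThetaProd n)))
      + C (2 * n + 8 * n ^ 2 : ℂ) * derivative (besselThetaProd n)
      - C 4 * (X * (X * derivative (besselThetaProd n)))
      + C (8 * n : ℂ) * (X * besselThetaProd n) = 0 := by
    simp only [C_mul, C_add, C_pow, C_eq_natCast, map_ofNat]
    linear_combination besselThetaProd_ode n
  have h := congrArg (fun f : ℂ[X] => f.coeff (j + 1)) e
  simp only [coeff_sub, coeff_add, coeff_C_mul, coeff_X_mul, coeff_zero] at h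
  cases j with
  | zero =>
    simp only [coeff_X_mul_zero, coeff_derivative] at h
    push_cast at h ⊢
    linear_combination h
  | succ j =>
    simp only [coeff_X_mul, coeff_derivative] at h
    push_cast at h ⊢
    linear_combination h

theorem besselThetaProd_coeff_odd (n k : ℕ) : (besselThetaProd n).coeff (2 * k + 1) = 0 := by
  have h : (besselThetaProd n).comp (-X) = besselThetaProd n := by
    simp only [besselThetaProd, besselThetaNeg, mul_comp, comp_assoc, neg_comp, X_comp, neg_neg,
      comp_X]
    ring
  have h2 := congrArg (fun f : ℂ[X] => f.coeff (2 * k + 1)) h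
  simp only [coeff_comp_neg_X, pow_succ, pow_mul] at h2
  norm_num at h2
  exact CharZero.neg_eq_self_iff.1 h2

theorem besselThetaProd_coeff_zero (n : ℕ) : (besselThetaProd n).coeff 0 =
    (((2 * n).factorial : ℂ) / n.factorial * (1 / 2) ^ n) ^ 2 := by
  rw [besselThetaProd, mul_coeff_zero, besselThetaNeg_coeff, besselTheta_coeff_zero]
  ring

theorem norm_besselThetaProd_coeff_le {n : ℕ} (hn : 0 < n) {k : ℕ} (hk : k ≤ n) :
    ‖(besselThetaProd n).coeff (2 * k)‖ ≤ ‖(besselThetaProd n).coeff 0‖ * (1 / (n : ℝ)) ^ k := by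
  induction k with
  | zero => simp
  | succ k ih =>
    have ih := ih (by omega)
    obtain ⟨d, rfl⟩ := Nat.exists_eq_add_of_lt (Nat.lt_of_succ_le hk)
    have h := besselThetaProd_coeff_add_two (k + d + 1) (2 * k)
    have h1 : ((k : ℂ) + 1) * (2 * d + 1) * (k + 2 * d + 2) *
        (besselThetaProd (k + d + 1)).coeff (2 * (k + 1)) =
        -(2 * (d + 1) * (besselThetaProd (k + d + 1)).coeff (2 * k)) := by
      push_cast at h ⊢
      rw [show 2 * (k + 1) = 2 * k + 2 by ring]
      linear_combination h / 4
    have h2 := congrArg norm h1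
    have e1 : ((k : ℂ) + 1) * (2 * d + 1) * (k + 2 * d + 2) =
      (((k + 1) * (2 * d + 1) * (k + 2 * d + 2) : ℕ) : ℂ) := by push_cast; ring
    have e2 : (2 * ((d : ℂ) + 1)) = ((2 * (d + 1) : ℕ) : ℂ) := by push_cast; ring
    rw [norm_neg, e1, e2, norm_mul, norm_mul, Complex.norm_natCast, Complex.norm_natCast] at h2
    set c := ‖(besselThetaProd (k + d + 1)).coeff (2 * (k + 1))‖
    set c' := ‖(besselThetaProd (k + d + 1)).coeff (2 * k)‖
    have hc : 0 ≤ c := norm_nonneg _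
    have hle : (k + d + 1) * (2 * (d + 1)) ≤ (k + 1) * (2 * d + 1) * (k + 2 * d + 2) := by
      calc (k + d + 1) * (2 * (d + 1)) ≤ ((k + 1) * (2 * d + 1)) * (k + 2 * d + 2) := by
            -- With n = k+d+1, the factors compare separately: n ≤ (k+1)(2d+1) and 2(d+1) ≤ k+2d+2.
            apply Nat.mul_le_mul <;> nlinarith [Nat.zero_le (k * d)]
        _ = _ := rfl
    have hle' : (((k + d + 1 : ℕ) : ℝ)) * ((2 * (d + 1) : ℕ) : ℝ) ≤
      (((k + 1) * (2 * d + 1) * (k + 2 * d + 2) : ℕ) : ℝ) := by exact_mod_cast hle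
    have hd : (0 : ℝ) < ((2 * (d + 1) : ℕ) : ℝ) := by positivity
    have hN : (0 : ℝ) < ((k + d + 1 : ℕ) : ℝ) := by positivity
    have h3 : ((k + d + 1 : ℕ) : ℝ) * c ≤ c' := by
      refine le_of_mul_le_mul_left ?_ hd
      rw [← h2]
      calc _ = ((k + d + 1 : ℕ) : ℝ) * ((2 * (d + 1) : ℕ) : ℝ) * c := by ring
        _ ≤ _ := mul_le_mul_of_nonneg_right hle' hc
    rw [pow_succ, ← mul_assoc, mul_one_div, le_div_iff₀ hN, mul_comm]
    exact h3.trans ih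

theorem eval_besselThetaProd (n : ℕ) (s : ℂ) : (besselThetaProd n).eval s =
    ∑ k ∈ Finset.range (n + 1), (besselThetaProd n).coeff (2 * k) * (s ^ 2) ^ k := by
  have hd : (besselThetaProd n).natDegree < 2 * (n + 1) := by
    refine natDegree_mul_le.trans_lt ?_
    rw [besselTheta_natDegree, besselThetaNeg_natDegree]; omega
  rw [eval_eq_sum_range' hd]
  have key : ∀ (f : ℕ → ℂ) (N : ℕ), (∀ k, f (2 * k + 1) = 0) →
      ∑ i ∈ Finset.range (2 * N), f i = ∑ k ∈ Finset.range N, f (2 * k) := by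
    intro f N hf
    induction N with
    | zero => simp
    | succ N ih =>
      rw [mul_add, mul_one, Finset.sum_range_succ, Finset.sum_range_succ, ih, hf, add_zero,
        Finset.sum_range_succ]
  rw [key _ _ (fun k => by rw [besselThetaProd_coeff_odd, zero_mul])]
  exact Finset.sum_congr rfl fun k _ => by rw [pow_mul]

theorem le_norm_eval_besselThetaProd {n : ℕ} (hn : 13 ≤ n) {s : ℂ}
    (hs : ‖s‖ ^ 2 ≤ ((n : ℝ) + 1) / 4) :
    12 / 19 * ‖(besselThetaProd n).coeff 0‖ ≤ ‖(besselThetaProd n).eval s‖ := by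
  have hn' : (13 : ℝ) ≤ n := by exact_mod_cast hn
  set c := ‖(besselThetaProd n).coeff 0‖
  -- For n ≥ 13, (n+1)/(4n) ≤ 14/52 = 7/26. The geometric tail is then at most 7/19 of the constant
  -- term, leaving 12/19.
  have hq : 1 / (n : ℝ) * ‖s‖ ^ 2 ≤ 7 / 26 := by
    rw [one_div, inv_mul_le_iff₀ (by linarith)]; linarith
  have hterm : ∀ k ∈ Finset.range n,
      ‖(besselThetaProd n).coeff (2 * (k + 1)) * (s ^ 2) ^ (k + 1)‖ ≤
        c * (7 / 26) * (7 / 26 : ℝ) ^ k := by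
    intro k hk
    rw [norm_mul, norm_pow, norm_pow]
    calc _ ≤ (c * (1 / (n : ℝ)) ^ (k + 1)) * (‖s‖ ^ 2) ^ (k + 1) :=
          mul_le_mul_of_nonneg_right (norm_besselThetaProd_coeff_le (by omega)
            (by have := Finset.mem_range.1 hk; omega)) (by positivity)
      _ = c * (1 / (n : ℝ) * ‖s‖ ^ 2) ^ (k + 1) := by rw [mul_pow]; ring
      _ ≤ c * (7 / 26) ^ (k + 1) := by gcongr
      _ = _ := by ring
  have hgeom : ∑ k ∈ Finset.range n, (7 / 26 : ℝ) ^ k ≤ 26 / 19 := by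
    have h := Summable.sum_le_tsum (Finset.range n) (fun k _ => by positivity)
      (summable_geometric_of_lt_one (r := (7 / 26 : ℝ)) (by norm_num) (by norm_num))
    rw [tsum_geometric_of_lt_one (by norm_num) (by norm_num)] at h
    norm_num at h ⊢; exact h
  have htail := (norm_sum_le_of_le _ hterm)
  rw [← Finset.mul_sum] at htail
  have htail2 := htail.trans (mul_le_mul_of_nonneg_left hgeom (by positivity))
  rw [eval_besselThetaProd, Finset.sum_range_succ']
  simp only [mul_zero, pow_zero, mul_one]
  have h := norm_sub_le_norm_add ((besselThetaProd n).coeff 0)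
    (∑ k ∈ Finset.range n, (besselThetaProd n).coeff (2 * (k + 1)) * (s ^ 2) ^ (k + 1))
  rw [add_comm] at h
  linarith
-- Sums over the zeros and the generating function
open Filter Topology Metric

theorem reverse_prod_X_sub_C (S : Multiset ℂ) :
    (S.map fun α => X - C α).prod.reverse = (S.map fun α => 1 - C α * X).prod := by
  induction S using Multiset.induction with
  | empty => simpa using reverse_C (1 : ℂ)
  | cons α S ih =>
    have h : (X - C α).reverse = 1 - C α * X := by
      have h1 : (X : ℂ[X]).reverse = 1 := by
        simpa using (reverse_mul_X (C (1 : ℂ))).trans (reverse_C 1)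
      rw [sub_eq_add_neg, ← C_neg, reverse_add_C, h1, natDegree_X, pow_one, C_neg]
      ring
    simp only [Multiset.map_cons, Multiset.prod_cons]
    rw [reverse_mul_of_domain, ih, h]

theorem besselTheta_eq_prod (n : ℕ) : besselTheta n = C (besselPoly n).leadingCoeff *
    ((besselPoly n).roots.map fun α => 1 - C α * X).prod := by
  rw [← reverse_prod_X_sub_C, besselTheta]
  conv_lhs => rw [(IsAlgClosed.splits (besselPoly n)).eq_prod_roots, reverse_mul_of_domain,
    reverse_C]

theorem eval_prod_one_sub_ne_zero {S : Multiset ℂ} {s : ℂ}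
    (h : (S.map fun α => 1 - C α * X).prod.eval s ≠ 0) {α : ℂ} (hα : α ∈ S) :
    1 - α * s ≠ 0 := by
  intro h0
  apply h
  rw [eval_multiset_prod]
  refine Multiset.prod_eq_zero ?_
  rw [Multiset.map_map, Multiset.mem_map]
  exact ⟨α, hα, by simpa using h0⟩

theorem eval_derivative_prod_one_sub (S : Multiset ℂ) (s : ℂ) (h : ∀ α ∈ S, 1 - α * s ≠ 0) :
    (derivative (S.map fun α => 1 - C α * X).prod).eval s =
      -((S.map fun α => 1 - C α * X).prod.eval s * (S.map fun α => α / (1 - α * s)).sum) := by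
  induction S using Multiset.induction with
  | empty => simp
  | cons α S ih =>
    have ih := ih fun β hβ => h β (Multiset.mem_cons_of_mem hβ)
    have hα := h α (Multiset.mem_cons_self α S)
    simp only [Multiset.map_cons, Multiset.prod_cons, Multiset.sum_cons, derivative_mul, eval_add,
      eval_mul, ih, derivative_sub, derivative_one, derivative_C, derivative_X, eval_sub, eval_one,
      eval_C, eval_X, eval_zero]
    generalize (S.map fun α => 1 - C α * X).prod.eval s = q
    generalize (S.map fun α => α / (1 - α * s)).sum = t
    linear_combination q * div_mul_cancel₀ α hα

theorem one_sub_root_mul_ne_zero {n : ℕ} {s : ℂ} (h : (besselTheta n).eval s ≠ 0) :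
    ∀ α ∈ (besselPoly n).roots, 1 - α * s ≠ 0 := by
  intro α hα
  rw [besselTheta_eq_prod, eval_mul] at h
  exact eval_prod_one_sub_ne_zero (right_ne_zero_of_mul h) hα

theorem eval_derivative_besselTheta {n : ℕ} {s : ℂ} (h : (besselTheta n).eval s ≠ 0) :
    (derivative (besselTheta n)).eval s =
      -((besselTheta n).eval s * ((besselPoly n).roots.map fun α => α / (1 - α * s)).sum) := by
  have h1 := eval_derivative_prod_one_sub _ s (one_sub_root_mul_ne_zero h)
  rw [besselTheta_eq_prod, derivative_C_mul, eval_mul, eval_mul, h1]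
  ring

theorem eval_besselThetaProd_eq (n : ℕ) (s : ℂ) :
    (besselThetaProd n).eval s = (besselTheta n).eval s * (besselTheta n).eval (-s) := by
  simp [besselThetaProd, besselThetaNeg]

/-- The Wronskian identity divided by θ(s)θ(-s), with the logarithmic derivatives written as sums
over the zeros. -/
theorem sum_roots_div_one_sub {n : ℕ} (hn : 0 < n) {s : ℂ} (h : (besselThetaProd n).eval s ≠ 0) :
    ((besselPoly n).roots.map fun α => α / (1 - α * s) + α / (1 + α * s)).sum =
      -2 + 2 * (-1) ^ n * s ^ (2 * n) / (besselThetaProd n).eval s := by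
  rw [eval_besselThetaProd_eq] at h ⊢
  have e1 := eval_derivative_besselTheta (left_ne_zero_of_mul h)
  have e2 := eval_derivative_besselTheta (right_ne_zero_of_mul h)
  have hw := congrArg (fun f : ℂ[X] => f.eval s) (besselTheta_wronskian hn)
  rw [derivative_besselThetaNeg, besselThetaNeg] at hw
  simp only [eval_sub, eval_mul, eval_neg, eval_comp,
    eval_X, eval_pow, eval_C, eval_ofNat] at hw
  rw [e1, e2] at hw
  simp only [mul_neg, sub_neg_eq_add] at hw
  rw [Multiset.sum_map_add]
  generalize ((besselPoly n).roots.map fun α => α / (1 - α * s)).sum = S1 at *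
  generalize ((besselPoly n).roots.map fun α => α / (1 + α * s)).sum = S2 at *
  rw [← sub_eq_iff_eq_add', eq_div_iff h]
  linear_combination -hw

theorem generating_sum_eq {n : ℕ} (hn : 0 < n) {z : ℂ} (hz : 1 - z ≠ 0)
    (h : (besselThetaProd n).eval (z / (2 * (1 - z))) ≠ 0) :
    z / (1 - z) ^ 2 -
      ((besselPoly n).roots.map fun α => (1 - nodeA α * z)⁻¹ - (1 - nodeB α * z)⁻¹).sum =
    2 * (z / (2 * (1 - z))) / (1 - z) * ((-1) ^ n * (z / (2 * (1 - z))) ^ (2 * n)) /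
      (besselThetaProd n).eval (z / (2 * (1 - z))) := by
  set s := z / (2 * (1 - z)) with hs
  have hzs : z = 2 * (1 - z) * s := by rw [hs]; field_simp
  have h' := h
  rw [eval_besselThetaProd_eq] at h'
  have key : ((besselPoly n).roots.map
      fun α => (1 - nodeA α * z)⁻¹ - (1 - nodeB α * z)⁻¹).sum =
      -(s / (1 - z)) *
        ((besselPoly n).roots.map fun α => α / (1 - α * s) + α / (1 + α * s)).sum := by
    rw [← Multiset.sum_map_mul_left]
    refine congrArg Multiset.sum (Multiset.map_congr rfl fun α hα => ?_)
    have h1 := one_sub_root_mul_ne_zero (left_ne_zero_of_mul h') α hα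
    have h2 := one_sub_root_mul_ne_zero (right_ne_zero_of_mul h') α hα
    rw [mul_neg, sub_neg_eq_add] at h2
    have ea : 1 - nodeA α * z = (1 - z) * (1 + α * s) := by
      rw [nodeA]; linear_combination α / 2 * hzs
    have eb : 1 - nodeB α * z = (1 - z) * (1 - α * s) := by
      rw [nodeB]; linear_combination -α / 2 * hzs
    rw [ea, eb]
    field_simp
    ring
  rw [key, sum_roots_div_one_sub hn h]
  have e : z / (1 - z) ^ 2 = 2 * s / (1 - z) := by rw [hs]; field_simp
  rw [e]
  field_simp
  ring

theorem eventually_hasSum_generating (S : Multiset ℂ) :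
    ∀ᶠ z in 𝓝 (0 : ℂ), HasSum
      (fun m : ℕ => z ^ m * (S.map fun α => nodeA α ^ m - nodeB α ^ m).sum)
      (S.map fun α => (1 - nodeA α * z)⁻¹ - (1 - nodeB α * z)⁻¹).sum := by
  have small : ∀ c : ℂ, ∀ᶠ z in 𝓝 (0 : ℂ), ‖c * z‖ < 1 := fun c => by
    have : ContinuousAt (fun z : ℂ => ‖c * z‖) 0 := by fun_prop
    exact this.eventually_lt continuousAt_const (by simp)
  induction S using Multiset.induction with
  | empty => simp
  | cons α S ih =>
    filter_upwards [ih, small (nodeA α), small (nodeB α)] with z h hA hB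
    simp only [Multiset.map_cons, Multiset.sum_cons]
    have h' := ((hasSum_geometric_of_norm_lt_one hA).sub
      (hasSum_geometric_of_norm_lt_one hB)).add h
    refine (congrArg (HasSum · _) (funext fun m => ?_)).mp h'
    rw [mul_pow, mul_pow]
    ring

theorem eventually_hasSum_sub_besselA (n : ℕ) :
    ∀ᶠ z in 𝓝 (0 : ℂ), HasSum (fun m : ℕ => z ^ m * ((m : ℂ) - besselA n m))
      (z / (1 - z) ^ 2 -
        ((besselPoly n).roots.map fun α => (1 - nodeA α * z)⁻¹ - (1 - nodeB α * z)⁻¹).sum) := by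
  have small : ∀ᶠ z in 𝓝 (0 : ℂ), ‖z‖ < 1 :=
    continuous_norm.continuousAt.eventually_lt continuousAt_const (by simp)
  filter_upwards [eventually_hasSum_generating (besselPoly n).roots, small] with z h hz
  have h' := (hasSum_coe_mul_geometric_of_norm_lt_one hz).sub h
  refine (congrArg (HasSum · _) (funext fun m => ?_)).mp h'
  rw [besselA]
  ring

/-! ### Cauchy's estimate and the conclusion -/

/-- The expansion is needed only near 0, since it already determines the derivatives of f there; no
convergence on the whole disc is assumed. -/
theorem norm_coeff_le_of_forall_mem_sphere_norm_le {f : ℂ → ℂ} {a : ℕ → ℂ} {r M : ℝ} (hr : 0 < r)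
    (hf : DiffContOnCl ℂ f (ball 0 r)) (hM : ∀ z ∈ sphere (0 : ℂ) r, ‖f z‖ ≤ M)
    (ha : ∀ᶠ z in 𝓝 (0 : ℂ), HasSum (fun m : ℕ => z ^ m * a m) (f z)) (m : ℕ) :
    ‖a m‖ ≤ M / r ^ m := by
  have hp : HasFPowerSeriesAt f (FormalMultilinearSeries.ofScalars ℂ a) 0 := by
    rw [hasFPowerSeriesAt_iff]
    simpa [FormalMultilinearSeries.coeff_ofScalars] using ha
  obtain ⟨ρ, hρ⟩ := hp
  have h := hρ.factorial_smul 1 m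
  rw [iteratedFDeriv_apply_eq_iteratedDeriv_mul_prod, Finset.prod_const_one, one_smul] at h
  have h2 := Complex.norm_iteratedDeriv_le_of_forall_mem_sphere_norm_le m hr hf hM
  have h3 : FormalMultilinearSeries.ofScalars ℂ a m (fun _ => (1 : ℂ)) = a m := by
    simp
  rw [← h, h3, nsmul_eq_mul, norm_mul, Complex.norm_natCast, mul_div_assoc] at h2
  exact le_of_mul_le_mul_left h2 (by exact_mod_cast m.factorial_pos)

theorem mainTheorem7 (x : ℝ) (hx0 : 0 < x) (hx1 : x < 1) (n : ℕ) (hn : nZero x ≤ (n : ℝ))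
    (m : ℕ) (hm : 2 * n + 1 ≤ m) :
    ‖(m : ℂ) - besselA n m‖ <
      2 * x ^ (2 * (n : ℤ) + 1 - (m : ℤ)) / (1 - x) ^ (2 * n + 2) *
        ((n.factorial : ℝ) ^ 2 / ((2 * n).factorial : ℝ) ^ 2) := by
  have hy : 0 < 1 - x := by linarith
  have hmax : max 14 (x ^ 2 / (1 - x) ^ 2) ≤ (n : ℝ) + 1 := by unfold nZero at hn; linarith
  have hn13 : 13 ≤ n := by
    have := (le_max_left _ _).trans hmax
    have h : (13 : ℝ) ≤ n := by linarith
    exact_mod_cast h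
  have hxn : x ^ 2 / (1 - x) ^ 2 ≤ (n : ℝ) + 1 := (le_max_right _ _).trans hmax
  set κ : ℝ := ((2 * n).factorial : ℝ) / n.factorial * (1 / 2) ^ n with hκ
  have hκ0 : 0 < κ := by
    have h1 : (0 : ℝ) < ((2 * n).factorial : ℝ) := by exact_mod_cast Nat.factorial_pos _
    have h2 : (0 : ℝ) < (n.factorial : ℝ) := by exact_mod_cast Nat.factorial_pos _
    positivity
  have hc : ‖(besselThetaProd n).coeff 0‖ = κ ^ 2 := by
    rw [besselThetaProd_coeff_zero, hκ]; simp
  have hnorm : ∀ z ∈ closedBall (0 : ℂ) x, 1 - x ≤ ‖1 - z‖ := fun z hz => by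
    have h := norm_sub_norm_le (1 : ℂ) z
    rw [mem_closedBall_zero_iff] at hz
    rw [norm_one] at h
    linarith
  have hne : ∀ z ∈ closedBall (0 : ℂ) x, 1 - z ≠ 0 := fun z hz =>
    norm_pos_iff.1 (hy.trans_le (hnorm z hz))
  have hs : ∀ z ∈ closedBall (0 : ℂ) x, ‖z / (2 * (1 - z))‖ ≤ x / (1 - x) / 2 := fun z hz => by
    have h1 := hnorm z hz
    rw [mem_closedBall_zero_iff] at hz
    rw [norm_div, norm_mul, Complex.norm_ofNat, div_div, mul_comm 2]
    gcongr
  have hg : ∀ z ∈ closedBall (0 : ℂ) x,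
      12 / 19 * κ ^ 2 ≤ ‖(besselThetaProd n).eval (z / (2 * (1 - z)))‖ := fun z hz => by
    rw [← hc]
    refine le_norm_eval_besselThetaProd hn13 ?_
    calc _ ≤ (x / (1 - x) / 2) ^ 2 := by gcongr; exact hs z hz
      _ = x ^ 2 / (1 - x) ^ 2 / 4 := by rw [div_pow, div_pow]; norm_num
      _ ≤ _ := by gcongr
  have hg0 : ∀ z ∈ closedBall (0 : ℂ) x, (besselThetaProd n).eval (z / (2 * (1 - z))) ≠ 0 :=
    fun z hz => norm_pos_iff.1 (lt_of_lt_of_le (by positivity) (hg z hz))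
  set f : ℂ → ℂ := fun z => 2 * (z / (2 * (1 - z))) / (1 - z) *
    ((-1) ^ n * (z / (2 * (1 - z))) ^ (2 * n)) /
      (besselThetaProd n).eval (z / (2 * (1 - z))) with hf
  have hdiff : DiffContOnCl ℂ f (ball 0 x) := by
    refine DifferentiableOn.diffContOnCl ?_
    rw [closure_ball _ hx0.ne']
    have h1 : DifferentiableOn ℂ (fun z : ℂ => z / (2 * (1 - z))) (closedBall 0 x) :=
      differentiableOn_id.div (by fun_prop) fun z hz => mul_ne_zero two_ne_zero (hne z hz)
    refine DifferentiableOn.div ?_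
      ((besselThetaProd n).differentiable.comp_differentiableOn h1) hg0
    refine DifferentiableOn.mul ?_ ((h1.pow _).const_mul _)
    exact (h1.const_mul _).div (by fun_prop) hne
  have hbound : ∀ z ∈ sphere (0 : ℂ) x, ‖f z‖ ≤
      x / (1 - x) / (1 - x) * (x / (1 - x) / 2) ^ (2 * n) / (12 / 19 * κ ^ 2) := fun z hz => by
    have hz' := sphere_subset_closedBall hz
    have h1 := hs z hz'
    have h2 := hnorm z hz'
    have h3 := hg z hz'
    have h4 : 2 * ‖z / (2 * (1 - z))‖ ≤ x / (1 - x) := by linarith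
    simp only [hf]
    rw [norm_div, norm_mul, norm_mul, norm_div, norm_mul, norm_pow, norm_pow, norm_neg, norm_one,
      one_pow, one_mul, Complex.norm_ofNat]
    gcongr
  have hev : ∀ᶠ z in 𝓝 (0 : ℂ), HasSum (fun m : ℕ => z ^ m * ((m : ℂ) - besselA n m)) (f z) := by
    filter_upwards [eventually_hasSum_sub_besselA n, closedBall_mem_nhds (0 : ℂ) hx0] with z h hz
    rwa [generating_sum_eq (by omega) (hne z hz) (hg0 z hz)] at h
  refine (norm_coeff_le_of_forall_mem_sphere_norm_le hx0 hdiff hbound hev m).trans_lt ?_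
  have hzp : x ^ (2 * (n : ℤ) + 1 - (m : ℤ)) = x ^ (2 * n + 1) / x ^ m := by
    rw [zpow_sub₀ hx0.ne', zpow_natCast]
    norm_cast
  have h1 : (0 : ℝ) < ((2 * n).factorial : ℝ) := by exact_mod_cast Nat.factorial_pos _
  have h2 : (0 : ℝ) < (n.factorial : ℝ) := by exact_mod_cast Nat.factorial_pos _
  have e : x / (1 - x) / (1 - x) * (x / (1 - x) / 2) ^ (2 * n) / (12 / 19 * κ ^ 2) / x ^ m =
      19 / 12 * (x ^ (2 * n + 1) / x ^ m / (1 - x) ^ (2 * n + 2) *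
        ((n.factorial : ℝ) ^ 2 / ((2 * n).factorial : ℝ) ^ 2)) := by
    rw [hκ]
    simp only [div_pow, mul_pow, one_pow, pow_add, pow_mul']
    field_simp
  rw [e, hzp, mul_div_assoc, mul_assoc]
  -- Strictness comes from 19/12 < 2.
  exact mul_lt_mul_of_pos_right (by norm_num) (by positivity)
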